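/- Let $\mathcal X,\mathcal Y$ be Polish spaces (for two stock prices, $\mathcal X=\mathcal Y=\mathbb R$), with Borel probability measures $P$ on $\mathcal X$ and $Q$ on $\mathcal Y$. An option with $P$-integrable payoff $u(X)$ trades at price $\mathbb E_P[u(X)]$, and an option with $Q$-integrable payoff $v(Y)$ trades at price $\mathbb E_Q[v(Y)]$. Let $\Phi:\mathcal X\times\mathcal Y\to\mathbb R$ be Borel measurable, with $|\Phi(x,y)|\le a(x)+b(y)$ for all $x,y$, for some $a\in L^1(P)$, $b\in L^1(Q)$. A relation between $x$ and $y$ is said to hold *almost surely* if it holds for all $(x,y)\in A\times B$ for some sets $A,B$ with $P(\mathcal X\setminus A)=Q(\mathcal Y\setminus B)=0$. When an option with payoff $\Phi(X,Y)$ is priced at $V\in\mathbb R$, an *arbitrage opportunity* based on the two single-underlying option markets consists of $u\in L^1(P)$, $v\in L^1(Q)$ and $k\in\mathbb R$ such that $u(x)+v(y)+k\,\Phi(x,y)\ge 0$ almost surely, while the cost is negative: $\mathbb E_P[u(X)]+\mathbb E_Q[v(Y)]+kV<0$. **Theorem.** The maximum and the minimum in $$\underline V=\max_{u\in L^1(P),\,v\in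 L^1(Q)}\ \mathbb E_P[u(X)]+\mathbb E_Q[v(Y)]\ \text{ s.t. } u(x)+v(y)\le\Phi(x,y)\text{ almost surely},$$ $$\overline V=\min_{u\in L^1(P),\,v\in L^1(Q)}\ \mathbb E_P[u(X)]+\mathbb E_Q[v(Y)]\ \text{ s.t. } u(x)+v(y)\ge\Phi(x,y)\text{ almost surely}$$ are attained and finite, and for every $V\in\mathbb R$ the price $V$ is not subject to an arbitrage opportunity if and only if $\underline V\le V\le\overline V$. The same characterization of the arbitrage-free prices holds if the payoff of an arbitrage opportunity is required to be nonnegative for all $(x,y)$ without exception, and $\underline V$ (resp. $\overline V$) is also the supremum (resp. infimum) of $\mathbb E_P[u(X)]+\mathbb E_Q[v(Y)]$ over the $u\in L^1(P)$, $v\in L^1(Q)$ that satisfy the constraint for all $(x,y)$ without exception. Moreover, let $\mathcal M(P,Q)$ be the set of Borel probability measures on $\mathcal X\times\mathcal Y$ with margins $P$ and $Q$. Then $\Phi$ is $\pi$-integrable for every $\pi\in\mathcal M(P,Q)$; if $\Phi$ is lower semicontinuous, then $\underline V=\min_{\pi\in\mathcal M(P,Q)}\mathbb E_\pi[\Phi(X,Y)]$,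 and if $\Phi$ is upper semicontinuous, then $\overline V=\max_{\pi\in\mathcal M(P,Q)}\mathbb E_\pi[\Phi(X,Y)]$, both attained. In particular both equalities hold when $\Phi$ is continuous. -/

import Mathlib

open MeasureTheory Filter

namespace OptionPricing

variable {X Y : Type*} [MeasurableSpace X] [MeasurableSpace Y]

/-- The couplings of `P` and `Q`: joint laws on `X × Y` with first margin `P` and
second margin `Q`. -/
def couplings (P : Measure X) (Q : Measure Y) : Set (Measure (X × Y)) :=
  {π | π.fst = P ∧ π.snd = Q}

/-- The prices `E_π[Φ(X, Y)]` of the option as `π` runs through the couplings. -/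
def couplingPrices (P : Measure X) (Q : Measure Y) (Φ : X × Y → ℝ) : Set ℝ :=
  {p | ∃ π ∈ couplings P Q, p = ∫ z, Φ z ∂π}

/-- The portfolios formed on the two single-underlying option markets: an option with integrable
payoff `u(X)` (price `E_P[u(X)]`) and one with integrable payoff `v(Y)` (price `E_Q[v(Y)]`). -/
structure Portfolio (P : Measure X) (Q : Measure Y) where
  u : X → ℝ
  v : Y → ℝ
  integrable_u : Integrable u P
  integrable_v : Integrable v Q

namespace Portfolio

variable {P : Measure X} {Q : Measure Y}

/-- Payoff of the portfolio in the state `z = (x, y)`. -/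
def payoff (w : Portfolio P Q) (z : X × Y) : ℝ := w.u z.1 + w.v z.2

/-- Market price of the portfolio. -/
noncomputable def price (w : Portfolio P Q) : ℝ := ∫ x, w.u x ∂P + ∫ y, w.v y ∂Q

end Portfolio

/-- The filter of the statements about `(x, y)` that hold for `P`-almost every `x` and
`Q`-almost every `y`, that is, on a set `A × B` where `P` and `Q` are carried by `A` and `B`. -/
def almostSure (P : Measure X) (Q : Measure Y) : Filter (X × Y) := ae P ×ˢ ae Q

/-- The statements about `(x, y)` that hold in every state of the world without exception. -/
def everyState (X Y : Type*) : Filter (X × Y) := ⊤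

/-- Prices of the portfolios that under-replicate `Φ`, in the states prescribed by `l`. -/
def underPrices (l : Filter (X × Y)) (P : Measure X) (Q : Measure Y) (Φ : X × Y → ℝ) : Set ℝ :=
  {p | ∃ w : Portfolio P Q, (∀ᶠ z in l, w.payoff z ≤ Φ z) ∧ p = w.price}

/-- Prices of the portfolios that over-replicate `Φ`, in the states prescribed by `l`. -/
def overPrices (l : Filter (X × Y)) (P : Measure X) (Q : Measure Y) (Φ : X × Y → ℝ) : Set ℝ :=
  {p | ∃ w : Portfolio P Q, (∀ᶠ z in l, Φ z ≤ w.payoff z) ∧ p = w.price}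

/-- Arbitrage opportunity when the option `Φ` is traded at `V`: a portfolio `w` of
single-underlying options and a (positive or negative) quantity `k` of the option whose total
payoff is nonnegative in the states prescribed by `l`, and whose total cost is negative. -/
def HasArbitrage (l : Filter (X × Y)) (P : Measure X) (Q : Measure Y) (Φ : X × Y → ℝ)
    (V : ℝ) : Prop :=
  ∃ (w : Portfolio P Q) (k : ℝ),
    (∀ᶠ z in l, 0 ≤ w.payoff z + k * Φ z) ∧ w.price + k * V < 0

end OptionPricing

/-!
Everything is proved for over-replication of `Φ`; the statements on under-replication are those
for `-Φ`, since `u + v ≤ Φ` means `-u - v ≥ -Φ`.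

*Attainment* (`OptionPricing.exists_isLeast_overPrices`). Since `-a - b ≤ Φ ≤ u + v`, a constant
can be moved from one leg to the other so that `u ≥ -a` and `v ≥ -b`. The over-replicating
portfolios form a lattice for the operations `(max u u', min v v')` and `(min u u', max v v')`, and
the sum of the prices of these two portfolios is the sum of the original prices. Along a minimizing
sequence whose excesses over the infimum are summable, the portfolios
`(sup_{n ≥ N} u n, inf_{n ≥ N} v n)` therefore have prices that tend to the infimum. They are
monotone in `N`, so the monotone convergence theorem supplies a minimizer; no compactness is used.

*Every state instead of almost every state* (`OptionPricing.exists_everyState_over_price_lt`).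
Bounding the legs below by `a - m` and `b - m` on the sets of full measure changes the price by an
amount that vanishes as `m → ∞`, and makes room for the values `a + m` and `b + m` on the
exceptional null sets.

*Arbitrage* (`OptionPricing.not_hasArbitrage_iff`) is then a matter of dividing by the number `k`
of options held; for `k = 0` one integrates against the product coupling.

*Duality* (`OptionPricing.exists_coupling_superPrice_le_integral`). The infimum of the prices of
over-replicating portfolios is a sublinear functional on the claims dominated by a portfolio. By
Hahn–Banach there is a linear functional `L` below it with equality at `Φ`. It is positive and
gives every portfolio its market price. Embed both spaces into the Hilbert cube: on the functions
that extend continuously to the product of the two cubes, `L` is a measure by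
Riesz–Markov–Kakutani, and as this measure has margins `P` and `Q` it comes from a coupling `π` of
`P` and `Q`. An upper semicontinuous `Φ`, cut off at a high level, is a limit from above of such
functions, whence `L Φ ≤ ∫ Φ dπ`; the part cut off is dominated by calls on `a` and `b` of small
price. The coupling `π` is thus optimal, and neither compactness of the set of couplings nor a
minimax theorem is needed.
-/

open Topology

namespace OptionPricing

section

variable {X Y : Type*} [MeasurableSpace X] [MeasurableSpace Y] {P : Measure X} {Q : Measure Y}

/-! ### Portfolios: linear and lattice operations -/

namespace Portfolio

instance : Add (Portfolio P Q) where
  add w w' := ⟨w.u + w'.u, w.v + w'.v, w.integrable_u.add w'.integrable_u,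
    w.integrable_v.add w'.integrable_v⟩

instance : SMul ℝ (Portfolio P Q) where
  smul c w := ⟨c • w.u, c • w.v, w.integrable_u.smul c, w.integrable_v.smul c⟩

/-- The larger first leg combined with the smaller second leg. -/
def join (w w' : Portfolio P Q) : Portfolio P Q :=
  ⟨w.u ⊔ w'.u, w.v ⊓ w'.v, w.integrable_u.sup w'.integrable_u, w.integrable_v.inf w'.integrable_v⟩

/-- The smaller first leg combined with the larger second leg. -/
def meet (w w' : Portfolio P Q) : Portfolio P Q :=
  ⟨w.u ⊓ w'.u, w.v ⊔ w'.v, w.integrable_u.inf w'.integrable_u, w.integrable_v.sup w'.integrable_v⟩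

/-- Transfer of the constant payoff `c` from the first leg to the second. -/
def transfer [IsFiniteMeasure P] [IsFiniteMeasure Q] (c : ℝ) (w : Portfolio P Q) :
    Portfolio P Q :=
  ⟨fun x => w.u x - c, fun y => w.v y + c, w.integrable_u.sub (integrable_const c),
    w.integrable_v.add (integrable_const c)⟩

@[simp]
theorem payoff_add (w w' : Portfolio P Q) (z : X × Y) :
    (w + w').payoff z = w.payoff z + w'.payoff z :=
  add_add_add_comm _ _ _ _

@[simp]
theorem price_add (w w' : Portfolio P Q) : (w + w').price = w.price + w'.price := by
  have h1 : ∫ x, (w + w').u x ∂P = ∫ x, w.u x ∂P + ∫ x, w'.u x ∂P :=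
    integral_add w.integrable_u w'.integrable_u
  have h2 : ∫ y, (w + w').v y ∂Q = ∫ y, w.v y ∂Q + ∫ y, w'.v y ∂Q :=
    integral_add w.integrable_v w'.integrable_v
  rw [price, price, price, h1, h2, add_add_add_comm]

@[simp]
theorem payoff_smul (c : ℝ) (w : Portfolio P Q) (z : X × Y) :
    (c • w).payoff z = c * w.payoff z :=
  (mul_add c (w.u z.1) (w.v z.2)).symm

@[simp]
theorem price_smul (c : ℝ) (w : Portfolio P Q) : (c • w).price = c * w.price := by
  have h1 : ∫ x, (c • w).u x ∂P = c * ∫ x, w.u x ∂P := integral_const_mul c w.u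
  have h2 : ∫ y, (c • w).v y ∂Q = c * ∫ y, w.v y ∂Q := integral_const_mul c w.v
  rw [price, price, h1, h2, mul_add]

/-- The price is modular: `max r s + min r s = r + s` in each leg. -/
theorem price_join_add_price_meet (w w' : Portfolio P Q) :
    (w.join w').price + (w.meet w').price = w.price + w'.price := by
  have h1 : ∫ x, (w.join w').u x ∂P + ∫ x, (w.meet w').u x ∂P
      = ∫ x, w.u x ∂P + ∫ x, w'.u x ∂P := by
    rw [← integral_add (w.join w').integrable_u (w.meet w').integrable_u,
      ← integral_add w.integrable_u w'.integrable_u]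
    exact integral_congr_ae (.of_forall fun x => max_add_min (w.u x) (w'.u x))
  have h2 : ∫ y, (w.join w').v y ∂Q + ∫ y, (w.meet w').v y ∂Q
      = ∫ y, w.v y ∂Q + ∫ y, w'.v y ∂Q := by
    rw [← integral_add (w.join w').integrable_v (w.meet w').integrable_v,
      ← integral_add w.integrable_v w'.integrable_v]
    exact integral_congr_ae (.of_forall fun y => min_add_max (w.v y) (w'.v y))
  simp only [price]
  linarith

theorem payoff_transfer [IsFiniteMeasure P] [IsFiniteMeasure Q] (c : ℝ) (w : Portfolio P Q)
    (z : X × Y) : (w.transfer c).payoff z = w.payoff z := by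
  simp only [payoff, transfer]
  ring

theorem price_transfer [IsProbabilityMeasure P] [IsProbabilityMeasure Q] (c : ℝ)
    (w : Portfolio P Q) : (w.transfer c).price = w.price := by
  have h1 : ∫ x, (w.transfer c).u x ∂P = ∫ x, w.u x ∂P - c :=
    (integral_sub w.integrable_u (integrable_const (μ := P) c)).trans (by simp)
  have h2 : ∫ y, (w.transfer c).v y ∂Q = ∫ y, w.v y ∂Q + c :=
    (integral_add w.integrable_v (integrable_const (μ := Q) c)).trans (by simp)
  rw [price, price, h1, h2]
  ring

theorem le_payoff_join {w w' : Portfolio P Q} {z : X × Y} {r : ℝ} (h : r ≤ w.payoff z)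
    (h' : r ≤ w'.payoff z) : r ≤ (w.join w').payoff z := by
  simp only [payoff, join, Pi.sup_apply, Pi.inf_apply] at h h' ⊢
  rcases le_total (w.v z.2) (w'.v z.2) with hv | hv
  · rw [inf_eq_left.2 hv]
    exact h.trans (add_le_add le_sup_left le_rfl)
  · rw [inf_eq_right.2 hv]
    exact h'.trans (add_le_add le_sup_right le_rfl)

theorem le_payoff_meet {w w' : Portfolio P Q} {z : X × Y} {r : ℝ} (h : r ≤ w.payoff z)
    (h' : r ≤ w'.payoff z) : r ≤ (w.meet w').payoff z := by
  simp only [payoff, meet, Pi.sup_apply, Pi.inf_apply] at h h' ⊢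
  rcases le_total (w.u z.1) (w'.u z.1) with hu | hu
  · rw [inf_eq_left.2 hu]
    exact h.trans (add_le_add le_rfl le_sup_left)
  · rw [inf_eq_right.2 hu]
    exact h'.trans (add_le_add le_rfl le_sup_right)

end Portfolio

/-! ### Almost sure statements and couplings -/

/-- An almost sure relation holds almost everywhere under every coupling. -/
theorem ae_le_almostSure {π : Measure (X × Y)} (hπ : π ∈ couplings P Q) :
    ae π ≤ almostSure P Q := by
  obtain ⟨rfl, rfl⟩ := hπ
  exact le_prod.2 ⟨(measurable_fst.measurePreserving π).quasiMeasurePreserving.tendsto_ae,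
    (measurable_snd.measurePreserving π).quasiMeasurePreserving.tendsto_ae⟩

theorem prod_mem_couplings [IsProbabilityMeasure P] [IsProbabilityMeasure Q] :
    P.prod Q ∈ couplings P Q := by
  simp [couplings]

namespace Portfolio

theorem integrable_payoff {π : Measure (X × Y)} (hπ : π ∈ couplings P Q) (w : Portfolio P Q) :
    Integrable w.payoff π := by
  obtain ⟨rfl, rfl⟩ := hπ
  exact (w.integrable_u.comp_measurable measurable_fst).add
    (w.integrable_v.comp_measurable measurable_snd)

theorem integral_payoff {π : Measure (X × Y)} (hπ : π ∈ couplings P Q) (w : Portfolio P Q) :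
    ∫ z, w.payoff z ∂π = w.price := by
  obtain ⟨rfl, rfl⟩ := hπ
  have h1 : ∫ x, w.u x ∂π.fst = ∫ z, w.u z.1 ∂π :=
    integral_map measurable_fst.aemeasurable w.integrable_u.1
  have h2 : ∫ y, w.v y ∂π.snd = ∫ z, w.v z.2 ∂π :=
    integral_map measurable_snd.aemeasurable w.integrable_v.1
  rw [price, h1, h2]
  exact integral_add (w.integrable_u.comp_measurable measurable_fst)
    (w.integrable_v.comp_measurable measurable_snd)

/-- Almost surely larger payoffs cost more, as one sees by integrating against a coupling. -/
theorem price_mono [IsProbabilityMeasure P] [IsProbabilityMeasure Q] {w w' : Portfolio P Q}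
    (h : ∀ᶠ z in almostSure P Q, w.payoff z ≤ w'.payoff z) : w.price ≤ w'.price := by
  have hπ : P.prod Q ∈ couplings P Q := prod_mem_couplings
  rw [← integral_payoff hπ, ← integral_payoff hπ]
  exact integral_mono_ae (w.integrable_payoff hπ) (w'.integrable_payoff hπ)
    (ae_le_almostSure hπ h)

end Portfolio

instance : CountableInterFilter (almostSure P Q) :=
  inferInstanceAs (CountableInterFilter (comap Prod.fst (ae P) ⊓ comap Prod.snd (ae Q)))

theorem eventually_almostSure_fst {p : X → Prop} (h : ∀ᵐ x ∂P, p x) :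
    ∀ᶠ z in almostSure P Q, p z.1 := h.prod_inl _

theorem eventually_almostSure_snd {p : Y → Prop} (h : ∀ᵐ y ∂Q, p y) :
    ∀ᶠ z in almostSure P Q, p z.2 := h.prod_inr _

end

section

/-! ### Monotone limits of integrable functions -/

/-- Monotone convergence in `L¹`: the limit is finite almost everywhere because the integrals
are bounded. -/
theorem exists_integrable_tendsto_of_monotone {Ω : Type*} [MeasurableSpace Ω] {μ : Measure Ω}
    {f : ℕ → Ω → ℝ} (hf : ∀ n, Integrable (f n) μ) (hmono : ∀ᵐ x ∂μ, Monotone fun n => f n x)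
    {C : ℝ} (hC : ∀ n, ∫ x, f n x ∂μ ≤ C) :
    ∃ g : Ω → ℝ, Integrable g μ ∧ (∀ᵐ x ∂μ, Tendsto (fun n => f n x) atTop (𝓝 (g x))) ∧
      Tendsto (fun n => ∫ x, f n x ∂μ) atTop (𝓝 (∫ x, g x ∂μ)) := by
  have hmeas : ∀ n, AEMeasurable (fun x => ENNReal.ofReal (f n x - f 0 x)) μ := fun n =>
    ((hf n).sub (hf 0)).1.aemeasurable.ennreal_ofReal
  have hfin : ∫⁻ x, ⨆ n, ENNReal.ofReal (f n x - f 0 x) ∂μ ≤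
      ENNReal.ofReal (C - ∫ x, f 0 x ∂μ) := by
    rw [lintegral_iSup' hmeas]
    · refine iSup_le fun n => ?_
      refine (ofReal_integral_eq_lintegral_ofReal ((hf n).sub (hf 0))
        (hmono.mono fun x hx => sub_nonneg.2 (hx (Nat.zero_le n)))).symm.trans_le ?_
      rw [integral_sub' (hf n) (hf 0)]
      exact ENNReal.ofReal_le_ofReal (sub_le_sub_right (hC n) _)
    · filter_upwards [hmono] with x hx m n hmn
      exact ENNReal.ofReal_le_ofReal (sub_le_sub_right (hx hmn) _)
  have hlim : ∀ᵐ x ∂μ, Tendsto (fun n => f n x) atTop (𝓝 (⨆ n, f n x)) := by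
    filter_upwards [hmono, ae_lt_top' (AEMeasurable.iSup hmeas)
      (hfin.trans_lt ENNReal.ofReal_lt_top).ne] with x hx hx'
    refine tendsto_atTop_ciSup hx ⟨f 0 x + (⨆ n, ENNReal.ofReal (f n x - f 0 x)).toReal, ?_⟩
    rintro _ ⟨n, rfl⟩
    have := (ENNReal.ofReal_le_iff_le_toReal hx'.ne).1
      (le_iSup (fun n => ENNReal.ofReal (f n x - f 0 x)) n)
    linarith
  have hg0 : AEStronglyMeasurable (fun x => ⨆ n, f n x) μ :=
    aestronglyMeasurable_of_tendsto_ae atTop (fun n => (hf n).1) hlim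
  have hdiff : Integrable (fun x => (⨆ n, f n x) - f 0 x) μ := by
    refine ⟨hg0.sub (hf 0).1, ?_⟩
    rw [hasFiniteIntegral_iff_ofReal]
    · refine (lintegral_mono_ae ?_).trans_lt (hfin.trans_lt ENNReal.ofReal_lt_top)
      filter_upwards [hlim] with x hx
      refine le_of_tendsto (ENNReal.tendsto_ofReal (hx.sub_const (f 0 x))) (.of_forall fun n => ?_)
      exact le_iSup (fun n => ENNReal.ofReal (f n x - f 0 x)) n
    · filter_upwards [hlim, hmono] with x hx hx'
      exact sub_nonneg.2 (hx'.ge_of_tendsto hx 0)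
  have hg : Integrable (fun x => ⨆ n, f n x) μ := 
    (hdiff.add (hf 0)).congr (.of_forall fun x => sub_add_cancel _ _)
  exact ⟨_, hg, hlim, integral_tendsto_of_tendsto_of_monotone hf hg hmono hlim⟩

theorem exists_integrable_tendsto_of_monotone_or_antitone {Ω : Type*} [MeasurableSpace Ω]
    {μ : Measure Ω} {f : ℕ → Ω → ℝ} (hf : ∀ n, Integrable (f n) μ)
    (hmono : (∀ᵐ x ∂μ, Monotone fun n => f n x) ∨ ∀ᵐ x ∂μ, Antitone fun n => f n x)
    {C : ℝ} (hC : ∀ n, |∫ x, f n x ∂μ| ≤ C) :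
    ∃ g : Ω → ℝ, Integrable g μ ∧ (∀ᵐ x ∂μ, Tendsto (fun n => f n x) atTop (𝓝 (g x))) ∧
      Tendsto (fun n => ∫ x, f n x ∂μ) atTop (𝓝 (∫ x, g x ∂μ)) := by
  rcases hmono with h | h
  · exact exists_integrable_tendsto_of_monotone hf h fun n => (abs_le.1 (hC n)).2
  · obtain ⟨g, hg, hlim, hint⟩ := exists_integrable_tendsto_of_monotone (fun n => (hf n).neg)
      (h.mono fun x hx m n hmn => neg_le_neg (hx hmn)) (C := C)
      fun n => by
        have := (abs_le.1 (hC n)).1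
        simp only [Pi.neg_apply, integral_neg]
        linarith
    refine ⟨-g, hg.neg, hlim.mono fun x hx => by simpa using hx.neg, ?_⟩
    simpa [integral_neg] using hint.neg

/-! ### Attainment of the minimal over-replication price -/

variable {X Y : Type*} [MeasurableSpace X] [MeasurableSpace Y] {P : Measure X} {Q : Measure Y}

/-- `w` over-replicates `Φ` almost surely and its legs are bounded below by `-a` and `-b`. -/
def IsNormalizedOver (Φ : X × Y → ℝ) (a : X → ℝ) (b : Y → ℝ) (w : Portfolio P Q) : Prop :=
  (∀ᶠ z in almostSure P Q, Φ z ≤ w.payoff z) ∧ (∀ᵐ x ∂P, -a x ≤ w.u x) ∧ ∀ᵐ y ∂Q, -b y ≤ w.v y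

variable {Φ : X × Y → ℝ} {a : X → ℝ} {b : Y → ℝ}

/-- Since `-a - b ≤ Φ ≤ u + v`, transferring the constant `inf (u + a)` makes both `u + a` and
`v + b` nonnegative. -/
theorem exists_isNormalizedOver [IsProbabilityMeasure P] [IsProbabilityMeasure Q]
    (hab : ∀ x y, |Φ (x, y)| ≤ a x + b y) {w : Portfolio P Q}
    (hw : ∀ᶠ z in almostSure P Q, Φ z ≤ w.payoff z) :
    ∃ w' : Portfolio P Q, IsNormalizedOver Φ a b w' ∧ w'.price = w.price := by
  obtain ⟨A, hA, B, hB, hAB⟩ := eventually_prod_iff.1 hw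
  obtain ⟨x₀, hx₀⟩ := hA.exists
  obtain ⟨y₀, hy₀⟩ := hB.exists
  have key : ∀ x, A x → ∀ y, B y → -(w.v y + b y) ≤ w.u x + a x := fun x hx y hy => by
    have h1 : Φ (x, y) ≤ w.u x + w.v y := hAB hx hy
    have := (abs_le.1 (hab x y)).1
    linarith
  let S : Set ℝ := (fun x => w.u x + a x) '' {x | A x}
  have hS : BddBelow S := by
    refine ⟨-(w.v y₀ + b y₀), ?_⟩
    rintro _ ⟨x, hx, rfl⟩
    exact key x hx y₀ hy₀
  refine ⟨w.transfer (sInf S), ⟨?_, ?_, ?_⟩, w.price_transfer _⟩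
  · simpa only [Portfolio.payoff_transfer] using hw
  · filter_upwards [hA] with x hx
    have : sInf S ≤ w.u x + a x := csInf_le hS ⟨x, hx, rfl⟩
    simp only [Portfolio.transfer]
    linarith
  · filter_upwards [hB] with y hy
    have : -(w.v y + b y) ≤ sInf S := by
      refine le_csInf ⟨_, x₀, hx₀, rfl⟩ ?_
      rintro _ ⟨x, hx, rfl⟩
      exact key x hx y hy
    simp only [Portfolio.transfer]
    linarith

theorem IsNormalizedOver.join {w w' : Portfolio P Q} (h : IsNormalizedOver Φ a b w)
    (h' : IsNormalizedOver Φ a b w') : IsNormalizedOver Φ a b (w.join w') := by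
  refine ⟨?_, ?_, ?_⟩
  · filter_upwards [h.1, h'.1] with z hz hz' using Portfolio.le_payoff_join hz hz'
  · filter_upwards [h.2.1] with x hx using hx.trans le_sup_left
  · filter_upwards [h.2.2, h'.2.2] with y hy hy' using le_inf hy hy'

theorem IsNormalizedOver.meet {w w' : Portfolio P Q} (h : IsNormalizedOver Φ a b w)
    (h' : IsNormalizedOver Φ a b w') : IsNormalizedOver Φ a b (w.meet w') := by
  refine ⟨?_, ?_, ?_⟩
  · filter_upwards [h.1, h'.1] with z hz hz' using Portfolio.le_payoff_meet hz hz'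
  · filter_upwards [h.2.1, h'.2.1] with x hx hx' using le_inf hx hx'
  · filter_upwards [h.2.2] with y hy using hy.trans le_sup_left

/-- Normalized over-replication passes to limits in which each leg is monotone. The lower bounds
on the legs and the bound on the price confine the two integrals. -/
theorem IsNormalizedOver.exists_limit (ha : Integrable a P) (hb : Integrable b Q)
    {w : ℕ → Portfolio P Q} (hw : ∀ n, IsNormalizedOver Φ a b (w n))
    (hu : (∀ᵐ x ∂P, Monotone fun n => (w n).u x) ∨ ∀ᵐ x ∂P, Antitone fun n => (w n).u x)
    (hv : (∀ᵐ y ∂Q, Monotone fun n => (w n).v y) ∨ ∀ᵐ y ∂Q, Antitone fun n => (w n).v y)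
    {C : ℝ} (hC : ∀ n, (w n).price ≤ C) :
    ∃ w' : Portfolio P Q, IsNormalizedOver Φ a b w' ∧
      (∀ᵐ x ∂P, Tendsto (fun n => (w n).u x) atTop (𝓝 (w'.u x))) ∧
      (∀ᵐ y ∂Q, Tendsto (fun n => (w n).v y) atTop (𝓝 (w'.v y))) ∧
      Tendsto (fun n => (w n).price) atTop (𝓝 w'.price) := by
  have hu_ge : ∀ n, -∫ x, a x ∂P ≤ ∫ x, (w n).u x ∂P := fun n => by
    rw [← integral_neg]
    exact integral_mono_ae ha.neg (w n).integrable_u (hw n).2.1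
  have hv_ge : ∀ n, -∫ y, b y ∂Q ≤ ∫ y, (w n).v y ∂Q := fun n => by
    rw [← integral_neg]
    exact integral_mono_ae hb.neg (w n).integrable_v (hw n).2.2
  have hprice : ∀ n, ∫ x, (w n).u x ∂P + ∫ y, (w n).v y ∂Q ≤ C := hC
  obtain ⟨u, hui, hul, huI⟩ := exists_integrable_tendsto_of_monotone_or_antitone
    (fun n => (w n).integrable_u) hu (C := |∫ x, a x ∂P| + |C + ∫ y, b y ∂Q|) fun n => by
      rw [abs_le]
      constructor
      · linarith [hu_ge n, le_abs_self (∫ x, a x ∂P), abs_nonneg (C + ∫ y, b y ∂Q)]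
      · linarith [hv_ge n, hprice n, le_abs_self (C + ∫ y, b y ∂Q), abs_nonneg (∫ x, a x ∂P)]
  obtain ⟨v, hvi, hvl, hvI⟩ := exists_integrable_tendsto_of_monotone_or_antitone
    (fun n => (w n).integrable_v) hv (C := |∫ y, b y ∂Q| + |C + ∫ x, a x ∂P|) fun n => by
      rw [abs_le]
      constructor
      · linarith [hv_ge n, le_abs_self (∫ y, b y ∂Q), abs_nonneg (C + ∫ x, a x ∂P)]
      · linarith [hu_ge n, hprice n, le_abs_self (C + ∫ x, a x ∂P), abs_nonneg (∫ y, b y ∂Q)]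
  refine ⟨⟨u, v, hui, hvi⟩, ⟨?_, ?_, ?_⟩, hul, hvl, huI.add hvI⟩
  · have hall : ∀ᶠ z in almostSure P Q, ∀ n, Φ z ≤ (w n).payoff z :=
      eventually_countable_forall.2 fun n => (hw n).1
    filter_upwards [hall, eventually_almostSure_fst hul, eventually_almostSure_snd hvl]
      with z hz h1 h2
    exact ge_of_tendsto (h1.add h2) (.of_forall hz)
  · filter_upwards [ae_all_iff.2 fun n => (hw n).2.1, hul] with x hx hl
    exact ge_of_tendsto hl (.of_forall hx)
  · filter_upwards [ae_all_iff.2 fun n => (hw n).2.2, hvl] with y hy hl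
    exact ge_of_tendsto hl (.of_forall hy)

/-- `iterJoin w k N` is the join of `w N, …, w (N + k)`. -/
def iterJoin (w : ℕ → Portfolio P Q) : ℕ → ℕ → Portfolio P Q
  | 0, N => w N
  | k + 1, N => (w N).join (iterJoin w k (N + 1))

theorem iterJoin_succ_ge (w : ℕ → Portfolio P Q) (k N : ℕ) :
    (iterJoin w k N).u ≤ (iterJoin w (k + 1) N).u ∧
      (iterJoin w (k + 1) N).v ≤ (iterJoin w k N).v := by
  induction k generalizing N with
  | zero => exact ⟨le_sup_left, inf_le_left⟩
  | succ k ih =>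
    exact ⟨sup_le_sup le_rfl (ih (N + 1)).1, inf_le_inf le_rfl (ih (N + 1)).2⟩

theorem iterJoin_le_of_tail (w : ℕ → Portfolio P Q) (k N : ℕ) :
    (iterJoin w k (N + 1)).u ≤ (iterJoin w (k + 1) N).u ∧
      (iterJoin w (k + 1) N).v ≤ (iterJoin w k (N + 1)).v :=
  ⟨le_sup_right, inf_le_right⟩

theorem isNormalizedOver_iterJoin {w : ℕ → Portfolio P Q}
    (hw : ∀ n, IsNormalizedOver Φ a b (w n)) (k N : ℕ) :
    IsNormalizedOver Φ a b (iterJoin w k N) := by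
  induction k generalizing N with
  | zero => exact hw N
  | succ k ih => exact (hw N).join (ih (N + 1))

/-- By modularity of the price, a join exceeds the minimal price by at most the sum of the two
excesses, the meet being itself a competitor. -/
theorem price_iterJoin_le {w : ℕ → Portfolio P Q} (hw : ∀ n, IsNormalizedOver Φ a b (w n))
    {S : ℝ} (hS : ∀ w' : Portfolio P Q, IsNormalizedOver Φ a b w' → S ≤ w'.price)
    (hwS : ∀ n, (w n).price ≤ S + (1 / 2) ^ n) (k N : ℕ) :
    (iterJoin w k N).price ≤ S + 2 * (1 / 2) ^ N := by
  induction k generalizing N with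
  | zero =>
    have : (0 : ℝ) < (1 / 2) ^ N := by positivity
    have := hwS N
    simp only [iterJoin]
    linarith
  | succ k ih =>
    have h1 := (w N).price_join_add_price_meet (iterJoin w k (N + 1))
    have h2 := hS _ ((hw N).meet (isNormalizedOver_iterJoin hw k (N + 1)))
    have h3 := ih (N + 1)
    have h4 := hwS N
    rw [pow_succ] at h3
    simp only [iterJoin]
    linarith

/-- The almost sure over-replication problem has a solution. Along a minimizing sequence `w n`,
the portfolios `(sup_{n ≥ N} u n, inf_{n ≥ N} v n)` are nearly optimal and monotone in `N`. -/
theorem exists_isLeast_overPrices [IsProbabilityMeasure P] [IsProbabilityMeasure Q]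
    (ha : Integrable a P) (hb : Integrable b Q) (hab : ∀ x y, |Φ (x, y)| ≤ a x + b y) :
    ∃ p, IsLeast (overPrices (almostSure P Q) P Q Φ) p := by
  let T : Set ℝ := {p | ∃ w : Portfolio P Q, IsNormalizedOver Φ a b w ∧ p = w.price}
  have hTne : T.Nonempty := by
    have h : ∀ᶠ z in almostSure P Q, Φ z ≤ (⟨a, b, ha, hb⟩ : Portfolio P Q).payoff z :=
      .of_forall fun z => (le_abs_self _).trans (hab z.1 z.2)
    obtain ⟨w, hw, -⟩ := exists_isNormalizedOver hab h
    exact ⟨_, w, hw, rfl⟩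
  have hTbdd : BddBelow T := by
    refine ⟨-∫ x, a x ∂P + -∫ y, b y ∂Q, ?_⟩
    rintro _ ⟨w, hw, rfl⟩
    rw [← integral_neg, ← integral_neg]
    exact add_le_add (integral_mono_ae ha.neg w.integrable_u hw.2.1)
      (integral_mono_ae hb.neg w.integrable_v hw.2.2)
  set S := sInf T
  have hS : ∀ w : Portfolio P Q, IsNormalizedOver Φ a b w → S ≤ w.price :=
    fun w hw => csInf_le hTbdd ⟨w, hw, rfl⟩
  have hseq : ∀ n : ℕ, ∃ w : Portfolio P Q, IsNormalizedOver Φ a b w ∧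
      w.price ≤ S + (1 / 2) ^ n := fun n => by
    obtain ⟨_, ⟨w, hw, rfl⟩, hlt⟩ :=
      exists_lt_of_csInf_lt hTne (lt_add_of_pos_right S (by positivity : (0 : ℝ) < (1 / 2) ^ n))
    exact ⟨w, hw, hlt.le⟩
  choose w hw hwS using hseq
  have htail : ∀ N, ∃ W : Portfolio P Q, IsNormalizedOver Φ a b W ∧
      (∀ᵐ x ∂P, Tendsto (fun k => (iterJoin w k N).u x) atTop (𝓝 (W.u x))) ∧
      (∀ᵐ y ∂Q, Tendsto (fun k => (iterJoin w k N).v y) atTop (𝓝 (W.v y))) ∧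
      Tendsto (fun k => (iterJoin w k N).price) atTop (𝓝 W.price) := fun N =>
    IsNormalizedOver.exists_limit ha hb (fun k => isNormalizedOver_iterJoin hw k N)
      (.inl (.of_forall fun x => monotone_nat_of_le_succ fun k => (iterJoin_succ_ge w k N).1 x))
      (.inr (.of_forall fun y => antitone_nat_of_succ_le fun k => (iterJoin_succ_ge w k N).2 y))
      (price_iterJoin_le hw hS hwS · N)
  choose W hW hWu hWv hWp using htail
  have hWS : ∀ N, (W N).price ≤ S + 2 * (1 / 2) ^ N := fun N =>
    le_of_tendsto (hWp N) (.of_forall (price_iterJoin_le hw hS hwS · N))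
  obtain ⟨W', hW', -, -, hW'p⟩ := IsNormalizedOver.exists_limit ha hb hW
    (.inr (by
      filter_upwards [ae_all_iff.2 hWu] with x hx
      exact antitone_nat_of_succ_le fun N => le_of_tendsto_of_tendsto' (hx (N + 1))
        ((tendsto_add_atTop_iff_nat 1).2 (hx N)) fun k => (iterJoin_le_of_tail w k N).1 x))
    (.inl (by
      filter_upwards [ae_all_iff.2 hWv] with y hy
      exact monotone_nat_of_le_succ fun N => le_of_tendsto_of_tendsto'
        ((tendsto_add_atTop_iff_nat 1).2 (hy N)) (hy (N + 1))
        fun k => (iterJoin_le_of_tail w k N).2 y))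
    (C := S + 2) fun N => (hWS N).trans (by
      have : ((1 : ℝ) / 2) ^ N ≤ 1 := pow_le_one₀ (by norm_num) (by norm_num)
      linarith)
  have hle : W'.price ≤ S := by
    have hlim : Tendsto (fun N : ℕ => S + 2 * ((1 : ℝ) / 2) ^ N) atTop (𝓝 (S + 2 * 0)) :=
      ((tendsto_pow_atTop_nhds_zero_of_lt_one (by norm_num) (by norm_num)).const_mul 2).const_add S
    simpa using le_of_tendsto_of_tendsto' hW'p hlim hWS
  refine ⟨W'.price, ⟨W', hW'.1, rfl⟩, ?_⟩
  rintro _ ⟨w', hw', rfl⟩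
  obtain ⟨w'', hw'', hp⟩ := exists_isNormalizedOver hab hw'
  exact hp ▸ hle.trans (hS _ hw'')

end

section

/-! ### Over-replication in every state -/

/-- The truncations `max u (a - m)` of `u` converge to `u` in mean. -/
theorem tendsto_integral_max_sub_nat {Ω : Type*} [MeasurableSpace Ω] {μ : Measure Ω}
    [IsFiniteMeasure μ] {u a : Ω → ℝ} (hu : Integrable u μ) (ha : Integrable a μ) :
    Tendsto (fun m : ℕ => ∫ x, max (u x) (a x - m) ∂μ) atTop (𝓝 (∫ x, u x ∂μ)) := by
  refine tendsto_integral_of_dominated_convergence (fun x => |u x| + |a x|)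
    (fun m => (hu.sup (ha.sub (integrable_const (m : ℝ)))).1) (hu.abs.add ha.abs)
    (fun m => .of_forall fun x => ?_) (.of_forall fun x => ?_)
  · have hm : (0 : ℝ) ≤ m := Nat.cast_nonneg m
    rw [Real.norm_eq_abs, abs_le]
    constructor
    · linarith [le_max_left (u x) (a x - m), neg_abs_le (u x), abs_nonneg (a x)]
    · refine max_le ?_ ?_
      · linarith [le_abs_self (u x), abs_nonneg (a x)]
      · linarith [le_abs_self (a x), abs_nonneg (u x)]
  · obtain ⟨n, hn⟩ := exists_nat_ge (a x - u x)
    refine tendsto_const_nhds.congr' ?_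
    filter_upwards [eventually_ge_atTop n] with m hm
    have : (n : ℝ) ≤ m := Nat.cast_le.2 hm
    exact (max_eq_left (by linarith)).symm

variable {X Y : Type*} [MeasurableSpace X] [MeasurableSpace Y] {P : Measure X} {Q : Measure Y}
  {Φ : X × Y → ℝ} {a : X → ℝ} {b : Y → ℝ}

theorem almostSure_le_everyState : almostSure P Q ≤ everyState X Y := le_top

/-- If the relation fails only outside `A × B`, replace the legs by `a + m` and `b + m` outside
`A` and `B`, and bound them below by `a - m` and `b - m` inside: then `a + b` is reached on the
exceptional states, at a cost that tends to zero with `m → ∞`. -/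
theorem exists_everyState_over_price_lt [IsProbabilityMeasure P] [IsProbabilityMeasure Q]
    (ha : Integrable a P) (hb : Integrable b Q) (hab : ∀ x y, |Φ (x, y)| ≤ a x + b y)
    {w : Portfolio P Q} (hw : ∀ᶠ z in almostSure P Q, Φ z ≤ w.payoff z) {c : ℝ}
    (hc : w.price < c) :
    ∃ w' : Portfolio P Q, (∀ᶠ z in everyState X Y, Φ z ≤ w'.payoff z) ∧ w'.price < c := by
  classical
  obtain ⟨A, hA, B, hB, hAB⟩ := eventually_prod_iff.1 hw
  have hlim := (tendsto_integral_max_sub_nat w.integrable_u ha).add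
    (tendsto_integral_max_sub_nat w.integrable_v hb)
  obtain ⟨m, hm⟩ := (hlim.eventually_lt_const hc).exists
  let u' : X → ℝ := fun x => if A x then max (w.u x) (a x - m) else a x + m
  let v' : Y → ℝ := fun y => if B y then max (w.v y) (b y - m) else b y + m
  have hu' : (fun x => max (w.u x) (a x - m)) =ᵐ[P] u' := hA.mono fun x hx => (if_pos hx).symm
  have hv' : (fun y => max (w.v y) (b y - m)) =ᵐ[Q] v' := hB.mono fun y hy => (if_pos hy).symm
  refine ⟨⟨u', v', (w.integrable_u.sup (ha.sub (integrable_const (m : ℝ)))).congr hu',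
    (w.integrable_v.sup (hb.sub (integrable_const (m : ℝ)))).congr hv'⟩, ?_, ?_⟩
  · refine eventually_top.2 fun z => ?_
    obtain ⟨x, y⟩ := z
    have h1 : Φ (x, y) ≤ a x + b y := (le_abs_self _).trans (hab x y)
    have h2 : (0 : ℝ) ≤ m := Nat.cast_nonneg m
    have h3 := le_max_right (w.u x) (a x - m)
    have h4 := le_max_right (w.v y) (b y - m)
    simp only [Portfolio.payoff, u', v']
    split_ifs with hx hy hy
    · exact (hAB hx hy).trans (add_le_add (le_max_left _ _) (le_max_left _ _))
    all_goals linarith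
  · rwa [Portfolio.price, ← integral_congr_ae hu', ← integral_congr_ae hv']

theorem isGLB_everyState_of_isLeast_almostSure [IsProbabilityMeasure P] [IsProbabilityMeasure Q]
    (ha : Integrable a P) (hb : Integrable b Q) (hab : ∀ x y, |Φ (x, y)| ≤ a x + b y) {p : ℝ}
    (hp : IsLeast (overPrices (almostSure P Q) P Q Φ) p) :
    IsGLB (overPrices (everyState X Y) P Q Φ) p := by
  constructor
  · rintro _ ⟨w, hw, rfl⟩
    exact hp.2 ⟨w, almostSure_le_everyState hw, rfl⟩
  · intro c hc
    obtain ⟨w, hw, rfl⟩ := hp.1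
    refine le_of_forall_gt fun d hd => ?_
    obtain ⟨w', hw', hlt⟩ := exists_everyState_over_price_lt ha hb hab hw hd
    exact (hc ⟨w', hw', rfl⟩).trans_lt hlt

/-! ### The over-replication price as a sublinear functional -/

/-- The claims whose absolute value is almost surely dominated by the payoff of a portfolio. -/
def dominatedClaims (P : Measure X) (Q : Measure Y) : Submodule ℝ (X × Y → ℝ) where
  carrier := {f | ∃ w : Portfolio P Q, ∀ᶠ z in almostSure P Q, |f z| ≤ w.payoff z}
  add_mem' := by
    rintro f g ⟨w, hw⟩ ⟨w', hw'⟩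
    refine ⟨w + w', ?_⟩
    filter_upwards [hw, hw'] with z hz hz'
    rw [Portfolio.payoff_add]
    exact (abs_add_le _ _).trans (add_le_add hz hz')
  zero_mem' := by
    refine ⟨⟨0, 0, integrable_zero _ _ _, integrable_zero _ _ _⟩, .of_forall fun z => ?_⟩
    simp [Portfolio.payoff]
  smul_mem' := by
    rintro c f ⟨w, hw⟩
    refine ⟨|c| • w, ?_⟩
    filter_upwards [hw] with z hz
    rw [Portfolio.payoff_smul, Pi.smul_apply, smul_eq_mul, abs_mul]
    exact mul_le_mul_of_nonneg_left hz (abs_nonneg c)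

/-- The infimum of the prices of almost surely over-replicating portfolios. For a dominated claim
the set of these prices is nonempty and bounded below, so that `sInf` is a genuine infimum. -/
noncomputable def superPrice (P : Measure X) (Q : Measure Y) (f : X × Y → ℝ) : ℝ :=
  sInf (overPrices (almostSure P Q) P Q f)

theorem exists_price_lt_of_superPrice_lt {f : X × Y → ℝ} (hf : f ∈ dominatedClaims P Q) {c : ℝ}
    (hc : superPrice P Q f < c) :
    ∃ w : Portfolio P Q, (∀ᶠ z in almostSure P Q, f z ≤ w.payoff z) ∧ w.price < c := by
  obtain ⟨w₀, hw₀⟩ := hf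
  have hne : (overPrices (almostSure P Q) P Q f).Nonempty :=
    ⟨w₀.price, w₀, hw₀.mono fun z hz => (le_abs_self _).trans hz, rfl⟩
  obtain ⟨_, ⟨w, hw, rfl⟩, hlt⟩ := exists_lt_of_csInf_lt hne hc
  exact ⟨w, hw, hlt⟩

variable [IsProbabilityMeasure P] [IsProbabilityMeasure Q]

theorem superPrice_le {f : X × Y → ℝ} (hf : f ∈ dominatedClaims P Q) {w : Portfolio P Q}
    (hw : ∀ᶠ z in almostSure P Q, f z ≤ w.payoff z) : superPrice P Q f ≤ w.price := by
  obtain ⟨w₀, hw₀⟩ := hf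
  refine csInf_le ⟨((-1 : ℝ) • w₀).price, ?_⟩ ⟨w, hw, rfl⟩
  rintro _ ⟨w', hw', rfl⟩
  refine Portfolio.price_mono ?_
  filter_upwards [hw₀, hw'] with z hz hz'
  rw [Portfolio.payoff_smul]
  linarith [neg_abs_le (f z)]

theorem superPrice_add_le {f g : X × Y → ℝ} (hf : f ∈ dominatedClaims P Q)
    (hg : g ∈ dominatedClaims P Q) :
    superPrice P Q (f + g) ≤ superPrice P Q f + superPrice P Q g := by
  refine le_of_forall_pos_le_add fun ε hε => ?_
  obtain ⟨w, hw, hlt⟩ := exists_price_lt_of_superPrice_lt hf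
    (lt_add_of_pos_right _ (half_pos hε))
  obtain ⟨w', hw', hlt'⟩ := exists_price_lt_of_superPrice_lt hg
    (lt_add_of_pos_right _ (half_pos hε))
  have hle : superPrice P Q (f + g) ≤ (w + w').price := by
    refine superPrice_le (add_mem hf hg) ?_
    filter_upwards [hw, hw'] with z hz hz'
    rw [Portfolio.payoff_add]
    exact add_le_add hz hz'
  rw [Portfolio.price_add] at hle
  linarith

theorem superPrice_smul_le {f : X × Y → ℝ} (hf : f ∈ dominatedClaims P Q) {c : ℝ} (hc : 0 < c) :
    superPrice P Q (c • f) ≤ c * superPrice P Q f := by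
  refine le_of_forall_gt fun d hd => ?_
  obtain ⟨w, hw, hlt⟩ := exists_price_lt_of_superPrice_lt hf ((lt_div_iff₀' hc).2 hd)
  refine (superPrice_le (w := c • w) (Submodule.smul_mem _ c hf) ?_).trans_lt ?_
  · filter_upwards [hw] with z hz
    rw [Portfolio.payoff_smul]
    exact mul_le_mul_of_nonneg_left hz hc.le
  · rw [Portfolio.price_smul]
    exact (lt_div_iff₀' hc).1 hlt

theorem superPrice_smul {f : X × Y → ℝ} (hf : f ∈ dominatedClaims P Q) {c : ℝ} (hc : 0 < c) :
    superPrice P Q (c • f) = c * superPrice P Q f := by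
  refine (superPrice_smul_le hf hc).antisymm ?_
  have h := superPrice_smul_le (Submodule.smul_mem _ c hf) (inv_pos.2 hc)
  rw [inv_smul_smul₀ hc.ne'] at h
  exact (le_inv_mul_iff₀ hc).1 h

/-- Hahn–Banach: a sublinear functional is touched at any given point by a linear functional
below it. -/
theorem exists_linearMap_le_sublinear_eq {E : Type*} [AddCommGroup E] [Module ℝ E] (N : E → ℝ)
    (N_hom : ∀ c : ℝ, 0 < c → ∀ x, N (c • x) = c * N x) (N_add : ∀ x y, N (x + y) ≤ N x + N y)
    (x₀ : E) : ∃ g : E →ₗ[ℝ] ℝ, g x₀ = N x₀ ∧ ∀ x, g x ≤ N x := by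
  have N_zero : N 0 = 0 := by
    have := N_hom 2 two_pos 0
    rw [smul_zero] at this
    linarith
  have hker : ∀ c : ℝ, c • x₀ = 0 → c • N x₀ = 0 := fun c hc => by
    rcases smul_eq_zero.1 hc with h | h
    · rw [h, zero_smul]
    · rw [h, N_zero, smul_zero]
  obtain ⟨g, hg, hgN⟩ := exists_extension_of_le_sublinear
    (LinearPMap.mkSpanSingleton' x₀ (N x₀) hker) N N_hom N_add (by
      rintro ⟨x, hx⟩
      obtain ⟨c, rfl⟩ := Submodule.mem_span_singleton.1 hx
      rw [LinearPMap.mkSpanSingleton'_apply, RingHom.id_apply, smul_eq_mul]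
      change c * N x₀ ≤ N (c • x₀)
      rcases lt_trichotomy c 0 with hc | rfl | hc
      · have h1 := N_add (c • x₀) ((-c) • x₀)
        rw [N_hom (-c) (neg_pos.2 hc), neg_smul, add_neg_cancel, N_zero] at h1
        linarith
      · rw [zero_smul, N_zero, zero_mul]
      · exact (N_hom c hc x₀).ge)
  exact ⟨g, (hg ⟨x₀, Submodule.mem_span_singleton_self x₀⟩).trans
    (LinearPMap.mkSpanSingleton'_apply_self x₀ (N x₀) hker _), hgN⟩

theorem exists_linearMap_le_superPrice_eq (f₀ : dominatedClaims P Q) :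
    ∃ L : dominatedClaims P Q →ₗ[ℝ] ℝ, L f₀ = superPrice P Q (f₀ : X × Y → ℝ) ∧
      ∀ f : dominatedClaims P Q, L f ≤ superPrice P Q (f : X × Y → ℝ) := by
  refine exists_linearMap_le_sublinear_eq
    (fun f : dominatedClaims P Q => superPrice P Q (f : X × Y → ℝ)) (fun c hc f => ?_)
    (fun f g => ?_) f₀
  · rw [Submodule.coe_smul]
    exact superPrice_smul f.2 hc
  · rw [Submodule.coe_add]
    exact superPrice_add_le f.2 g.2

theorem linearMap_le_price {L : dominatedClaims P Q →ₗ[ℝ] ℝ} 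
    (hL : ∀ f : dominatedClaims P Q, L f ≤ superPrice P Q (f : X × Y → ℝ))
    {f : dominatedClaims P Q} {w : Portfolio P Q}
    (hw : ∀ᶠ z in almostSure P Q, (f : X × Y → ℝ) z ≤ w.payoff z) : L f ≤ w.price :=
  (hL f).trans (superPrice_le f.2 hw)

/-- A linear functional below the over-replication price gives every portfolio its market
price. -/
theorem linearMap_eq_price {L : dominatedClaims P Q →ₗ[ℝ] ℝ} 
    (hL : ∀ f : dominatedClaims P Q, L f ≤ superPrice P Q (f : X × Y → ℝ))
    {f : dominatedClaims P Q} {w : Portfolio P Q}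
    (hw : ∀ᶠ z in almostSure P Q, (f : X × Y → ℝ) z = w.payoff z) : L f = w.price := by
  refine (linearMap_le_price hL (hw.mono fun z hz => hz.le)).antisymm ?_
  have h := linearMap_le_price hL (f := -f) (w := (-1 : ℝ) • w) (hw.mono fun z hz => by
    simp [hz])
  rw [map_neg, Portfolio.price_smul] at h
  linarith

theorem linearMap_mono {L : dominatedClaims P Q →ₗ[ℝ] ℝ} 
    (hL : ∀ f : dominatedClaims P Q, L f ≤ superPrice P Q (f : X × Y → ℝ))
    {f g : dominatedClaims P Q} (hfg : ∀ z, (f : X × Y → ℝ) z ≤ (g : X × Y → ℝ) z) :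
    L f ≤ L g := by
  have h := linearMap_le_price hL (f := f - g)
    (w := ⟨0, 0, integrable_zero _ _ _, integrable_zero _ _ _⟩) (.of_forall fun z => by
      simpa [Portfolio.payoff] using hfg z)
  rw [map_sub] at h
  simpa [Portfolio.price] using h

theorem bounded_mem_dominatedClaims {f : X × Y → ℝ} {C : ℝ} (hf : ∀ z, |f z| ≤ C) :
    f ∈ dominatedClaims P Q :=
  ⟨⟨fun _ => C, fun _ => 0, integrable_const _, integrable_const _⟩, .of_forall fun z => by
    simpa [Portfolio.payoff] using hf z⟩

end

section

/-! ### Couplings from linear functionals -/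

/-- A joint law on `K₁ × K₂` whose margins are the images of `P` and `Q` under measurable
embeddings is carried by `F(X) × G(Y)`, hence is the image of a coupling of `P` and `Q`. -/
theorem exists_coupling_map_eq {X Y K₁ K₂ : Type*} [MeasurableSpace X] [MeasurableSpace Y]
    [MeasurableSpace K₁] [MeasurableSpace K₂] {P : Measure X} {Q : Measure Y}
    {F : X → K₁} {G : Y → K₂} (hF : MeasurableEmbedding F) (hG : MeasurableEmbedding G)
    {μ : Measure (K₁ × K₂)} (h₁ : μ.fst = P.map F) (h₂ : μ.snd = Q.map G) :
    ∃ π ∈ couplings P Q, π.map (Prod.map F G) = μ := by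
  have hj : MeasurableEmbedding (Prod.map F G) := hF.prodMap hG
  have hmap : (μ.comap (Prod.map F G)).map (Prod.map F G) = μ := by
    rw [hj.map_comap]
    refine Measure.restrict_eq_self_of_ae_mem ?_
    have hf : ∀ᵐ k ∂μ, k.1 ∈ Set.range F := by
      refine ae_of_ae_map measurable_fst.aemeasurable (p := (· ∈ Set.range F)) ?_
      change ∀ᵐ k ∂μ.fst, k ∈ Set.range F
      rw [h₁]
      exact (ae_map_mem_range F hF.measurableSet_range P)
    have hg : ∀ᵐ k ∂μ, k.2 ∈ Set.range G := by
      refine ae_of_ae_map measurable_snd.aemeasurable (p := (· ∈ Set.range G)) ?_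
      change ∀ᵐ k ∂μ.snd, k ∈ Set.range G
      rw [h₂]
      exact (ae_map_mem_range G hG.measurableSet_range Q)
    filter_upwards [hf, hg] with k hk hk'
    rw [Set.range_prodMap]
    exact ⟨hk, hk'⟩
  refine ⟨μ.comap (Prod.map F G), ⟨?_, ?_⟩, hmap⟩
  · have h : (μ.comap (Prod.map F G)).fst.map F = P.map F := by
      rw [← h₁, ← hmap, Measure.fst, Measure.fst, Measure.map_map hF.measurable measurable_fst,
        Measure.map_map measurable_fst hj.measurable, hmap]
      rfl
    rw [← hF.comap_map P, ← h, hF.comap_map]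
  · have h : (μ.comap (Prod.map F G)).snd.map G = Q.map G := by
      rw [← h₂, ← hmap, Measure.snd, Measure.snd, Measure.map_map hG.measurable measurable_snd,
        Measure.map_map measurable_snd hj.measurable, hmap]
      rfl
    rw [← hG.comap_map Q, ← h, hG.comap_map]

theorem comp_prodMap_mem_dominatedClaims {X Y K₁ K₂ : Type*} [MeasurableSpace X]
    [MeasurableSpace Y] {P : Measure X} {Q : Measure Y} [IsProbabilityMeasure P]
    [IsProbabilityMeasure Q] [TopologicalSpace K₁] [CompactSpace K₁] [TopologicalSpace K₂]
    [CompactSpace K₂] (F : X → K₁) (G : Y → K₂) (g : C(K₁ × K₂, ℝ)) :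
    (fun z => g (Prod.map F G z)) ∈ dominatedClaims P Q :=
  bounded_mem_dominatedClaims (C := ‖g‖) fun _ => g.norm_coe_le_norm _

/-- A linear functional below the over-replication price is integration against a coupling on the
functions that extend continuously to a compactification of the product: Riesz–Markov–Kakutani
yields a measure on the compactification, and since the functional prices the single-underlying
options correctly, this measure has the right margins. -/
theorem exists_coupling_integral_eq_linearMap {X Y K₁ K₂ : Type*} [MeasurableSpace X]
    [MeasurableSpace Y] {P : Measure X} {Q : Measure Y} [IsProbabilityMeasure P]
    [IsProbabilityMeasure Q]
    [TopologicalSpace K₁] [CompactSpace K₁] [TopologicalSpace.MetrizableSpace K₁]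
    [MeasurableSpace K₁] [BorelSpace K₁]
    [TopologicalSpace K₂] [CompactSpace K₂] [TopologicalSpace.MetrizableSpace K₂]
    [MeasurableSpace K₂] [BorelSpace K₂]
    {F : X → K₁} {G : Y → K₂} (hF : MeasurableEmbedding F) (hG : MeasurableEmbedding G)
    {L : dominatedClaims P Q →ₗ[ℝ] ℝ}
    (hL : ∀ f : dominatedClaims P Q, L f ≤ superPrice P Q (f : X × Y → ℝ)) :
    ∃ π ∈ couplings P Q, ∀ g : C(K₁ × K₂, ℝ), ∫ z, g (Prod.map F G z) ∂π =
      L ⟨fun z => g (Prod.map F G z), comp_prodMap_mem_dominatedClaims F G g⟩ := by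
  let _ := TopologicalSpace.metrizableSpaceMetric K₁
  let _ := TopologicalSpace.metrizableSpaceMetric K₂
  let Λ : CompactlySupportedContinuousMap (K₁ × K₂) ℝ →ₚ[ℝ] ℝ :=
    { toFun g := L ⟨fun z => g (Prod.map F G z), comp_prodMap_mem_dominatedClaims F G g⟩
      map_add' g g' := L.map_add
        ⟨fun z => g (Prod.map F G z), comp_prodMap_mem_dominatedClaims F G g⟩
        ⟨fun z => g' (Prod.map F G z), comp_prodMap_mem_dominatedClaims F G g'⟩
      map_smul' c g := L.map_smul c
        ⟨fun z => g (Prod.map F G z), comp_prodMap_mem_dominatedClaims F G g⟩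
      monotone' g g' hgg' := linearMap_mono hL fun z => hgg' _ }
  have hΛ : ∀ g : C(K₁ × K₂, ℝ), ∫ k, g k ∂(RealRMK.rieszMeasure Λ) =
      L ⟨fun z => g (Prod.map F G z), comp_prodMap_mem_dominatedClaims F G g⟩ := fun g =>
    RealRMK.integral_rieszMeasure Λ ⟨g, HasCompactSupport.of_compactSpace _⟩
  have hfin : IsFiniteMeasure (RealRMK.rieszMeasure Λ) := inferInstance
  generalize RealRMK.rieszMeasure Λ = μ at hΛ hfin
  have h₁ : μ.fst = P.map F := by
    refine ext_of_forall_integral_eq_of_IsFiniteMeasure fun g => ?_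
    have hgF : Integrable (fun x => g (F x)) P :=
      (g.integrable (P.map F)).comp_measurable hF.measurable
    have h := linearMap_eq_price hL (w := ⟨fun x => g (F x), 0, hgF, integrable_zero _ _ _⟩)
      (f := ⟨_, comp_prodMap_mem_dominatedClaims F G (g.toContinuousMap.comp ContinuousMap.fst)⟩)
      (.of_forall fun z => (add_zero (g (F z.1))).symm)
    rw [← hΛ] at h
    rw [Measure.fst, integral_map measurable_fst.aemeasurable g.continuous.aestronglyMeasurable,
      integral_map hF.measurable.aemeasurable g.continuous.aestronglyMeasurable]
    exact h.trans (by simp [Portfolio.price])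
  have h₂ : μ.snd = Q.map G := by
    refine ext_of_forall_integral_eq_of_IsFiniteMeasure fun g => ?_
    have hgG : Integrable (fun y => g (G y)) Q :=
      (g.integrable (Q.map G)).comp_measurable hG.measurable
    have h := linearMap_eq_price hL (w := ⟨0, fun y => g (G y), integrable_zero _ _ _, hgG⟩)
      (f := ⟨_, comp_prodMap_mem_dominatedClaims F G (g.toContinuousMap.comp ContinuousMap.snd)⟩)
      (.of_forall fun z => (zero_add (g (G z.2))).symm)
    rw [← hΛ] at h
    rw [Measure.snd, integral_map measurable_snd.aemeasurable g.continuous.aestronglyMeasurable,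
      integral_map hG.measurable.aemeasurable g.continuous.aestronglyMeasurable]
    exact h.trans (by simp [Portfolio.price])
  obtain ⟨π, hπ, hπμ⟩ := exists_coupling_map_eq hF hG h₁ h₂
  refine ⟨π, hπ, fun g => ?_⟩
  rw [← hΛ g, ← hπμ, integral_map (hF.prodMap hG).measurable.aemeasurable
    g.continuous.aestronglyMeasurable]

/-! ### Approximation of semicontinuous functions -/

/-- An upper semicontinuous function `f ≤ M` is the limit from above of continuous functions that
extend to the space `Z` into which its domain embeds, namely of the Lipschitz regularizations
`z ↦ ⨆ w, f w - n * dist z (j w)`. -/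
theorem exists_continuousMap_tendsto_of_upperSemicontinuous {W Z : Type*} [TopologicalSpace W]
    [Nonempty W] [TopologicalSpace Z] [TopologicalSpace.MetrizableSpace Z] {j : W → Z}
    (hj : IsInducing j) {f : W → ℝ} (hf : UpperSemicontinuous f) {M : ℝ} (hM : ∀ w, f w ≤ M) :
    ∃ g : ℕ → C(Z, ℝ), (∀ n w, f w ≤ g n (j w)) ∧ (∀ n z, g n z ≤ M) ∧
      ∀ w, Tendsto (fun n => g n (j w)) atTop (𝓝 (f w)) := by
  let _ := TopologicalSpace.metrizableSpaceMetric Z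
  let g : ℕ → Z → ℝ := fun n z => ⨆ w, (f w - n * dist z (j w))
  have hterm : ∀ (n : ℕ) (z : Z) (w : W), f w - n * dist z (j w) ≤ M := fun n z w => by
    have : 0 ≤ (n : ℝ) * dist z (j w) := by positivity
    linarith [hM w]
  have hbdd : ∀ (n : ℕ) (z : Z), BddAbove (Set.range fun w => f w - n * dist z (j w)) := by
    refine fun n z => ⟨M, ?_⟩
    rintro _ ⟨w, rfl⟩
    exact hterm n z w
  have hlip : ∀ n : ℕ, LipschitzWith n (g n) := fun n => by
    refine LipschitzWith.of_le_add_mul _ fun z z' => ciSup_le fun w => ?_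
    have h1 : f w - n * dist z' (j w) ≤ g n z' := le_ciSup (hbdd n z') w
    have h2 : (n : ℝ) * dist z' (j w) ≤ n * (dist z z' + dist z (j w)) :=
      mul_le_mul_of_nonneg_left (dist_triangle_left z' (j w) z) (Nat.cast_nonneg n)
    rw [NNReal.coe_natCast]
    linarith
  have hfg : ∀ n w, f w ≤ g n (j w) := fun n w => by
    simpa using le_ciSup (hbdd n (j w)) w
  refine ⟨fun n => ⟨g n, (hlip n).continuous⟩, hfg, fun n z => ciSup_le (hterm n z), fun w => ?_⟩
  refine tendsto_order.2 ⟨fun r hr => .of_forall fun n => hr.trans_le (hfg n w), fun r hr => ?_⟩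
  obtain ⟨s, hs, hsr⟩ := exists_between hr
  have hev : ∀ᶠ w' in 𝓝 w, f w' < s := hf w s hs
  rw [hj.nhds_eq_comap, eventually_comap] at hev
  obtain ⟨δ, hδ, hball⟩ := Metric.eventually_nhds_iff.1 hev
  -- outside the `δ`-ball the penalty `n * δ` brings the terms below `s`
  obtain ⟨n₀, hn₀⟩ := exists_nat_ge ((M - s) / δ)
  filter_upwards [eventually_ge_atTop n₀] with n hn
  refine (ciSup_le fun w' => ?_).trans_lt hsr
  rcases lt_or_ge (dist (j w') (j w)) δ with hd | hd
  · have : 0 ≤ (n : ℝ) * dist (j w) (j w') := by positivity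
    linarith [hball hd w' rfl]
  · have h1 : (M - s) / δ ≤ n := hn₀.trans (Nat.cast_le.2 hn)
    have h2 : (n : ℝ) * δ ≤ n * dist (j w) (j w') := by
      rw [dist_comm] at hd
      exact mul_le_mul_of_nonneg_left hd (Nat.cast_nonneg n)
    rw [div_le_iff₀ hδ] at h1
    linarith [hM w']

/-! ### Kantorovich duality -/

variable {X Y : Type*} [MeasurableSpace X] [MeasurableSpace Y] {P : Measure X} {Q : Measure Y}
  {Φ : X × Y → ℝ} {a : X → ℝ} {b : Y → ℝ}

theorem integrable_of_mem_couplings (hΦ : Measurable Φ) (ha : Integrable a P)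
    (hb : Integrable b Q) (hab : ∀ x y, |Φ (x, y)| ≤ a x + b y) {π : Measure (X × Y)}
    (hπ : π ∈ couplings P Q) : Integrable Φ π :=
  ((⟨a, b, ha, hb⟩ : Portfolio P Q).integrable_payoff hπ).mono' hΦ.aestronglyMeasurable
    (.of_forall fun z => hab z.1 z.2)

theorem integral_le_of_mem_overPrices (hΦ : Measurable Φ) (ha : Integrable a P)
    (hb : Integrable b Q) (hab : ∀ x y, |Φ (x, y)| ≤ a x + b y) {π : Measure (X × Y)}
    (hπ : π ∈ couplings P Q) {p : ℝ} (hp : p ∈ overPrices (almostSure P Q) P Q Φ) :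
    ∫ z, Φ z ∂π ≤ p := by
  obtain ⟨w, hw, rfl⟩ := hp
  rw [← Portfolio.integral_payoff hπ]
  exact integral_mono_ae (integrable_of_mem_couplings hΦ ha hb hab hπ) (w.integrable_payoff hπ)
    (ae_le_almostSure hπ hw)

/-- The part of a claim above the level `2 m` is dominated by the calls `(a - m)⁺` and `(b - m)⁺`,
whose prices vanish as `m → ∞`. -/
theorem linearMap_le_of_min_le [IsProbabilityMeasure P] [IsProbabilityMeasure Q]
    (ha : Integrable a P) (hb : Integrable b Q) (hab : ∀ x y, |Φ (x, y)| ≤ a x + b y)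
    {L : dominatedClaims P Q →ₗ[ℝ] ℝ}
    (hL : ∀ f : dominatedClaims P Q, L f ≤ superPrice P Q (f : X × Y → ℝ))
    (hΦ : Φ ∈ dominatedClaims P Q) {c : ℝ}
    (hc : ∀ (m : ℕ) (f : dominatedClaims P Q),
      (∀ z, (f : X × Y → ℝ) z = min (Φ z) (2 * m)) → L f ≤ c) :
    L ⟨Φ, hΦ⟩ ≤ c := by
  have hlim := ((tendsto_integral_max_sub_nat (integrable_zero X ℝ P) ha).add
    (tendsto_integral_max_sub_nat (integrable_zero Y ℝ Q) hb)).const_add c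
  simp only [Pi.zero_apply, integral_zero, add_zero] at hlim
  refine ge_of_tendsto' hlim fun m => ?_
  have hm : (fun z => min (Φ z) (2 * m)) ∈ dominatedClaims P Q := by
    refine ⟨⟨a, fun y => b y + 2 * m, ha, hb.add (integrable_const _)⟩, .of_forall fun z => ?_⟩
    have h := hab z.1 z.2
    have hm : (0 : ℝ) ≤ m := Nat.cast_nonneg m
    rw [abs_le] at h ⊢
    simp only [Portfolio.payoff]
    exact ⟨le_min (by linarith) (by linarith), (min_le_left _ _).trans (by linarith)⟩
  let w : Portfolio P Q := ⟨fun x => max 0 (a x - m), fun y => max 0 (b y - m),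
    (integrable_zero X ℝ P).sup (ha.sub (integrable_const (m : ℝ))),
    (integrable_zero Y ℝ Q).sup (hb.sub (integrable_const (m : ℝ)))⟩
  have h := linearMap_le_price hL (f := ⟨Φ, hΦ⟩ - ⟨_, hm⟩) (w := w) (.of_forall fun z => by
    have h1 : Φ z ≤ a z.1 + b z.2 := (le_abs_self _).trans (hab z.1 z.2)
    have h2 := le_max_left 0 (a z.1 - m)
    have h3 := le_max_right 0 (a z.1 - m)
    have h4 := le_max_left 0 (b z.2 - m)
    have h5 := le_max_right 0 (b z.2 - m)
    change Φ z - min (Φ z) (2 * m) ≤ max 0 (a z.1 - m) + max 0 (b z.2 - m)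
    rcases min_choice (Φ z) (2 * m) with h | h <;> rw [h] <;> linarith)
  have h' := hc m ⟨_, hm⟩ fun z => rfl
  rw [map_sub] at h
  change _ ≤ c + w.price
  linarith

/-- Duality for upper semicontinuous claims. A Hahn–Banach functional `L` that touches the
over-replication price at `Φ` is represented by a coupling `π` on continuous functions, and
`L Φ ≤ ∫ Φ dπ` follows by approximating `Φ` from above. -/
theorem exists_coupling_superPrice_le_integral
    [TopologicalSpace X] [PolishSpace X] [BorelSpace X]
    [TopologicalSpace Y] [PolishSpace Y] [BorelSpace Y]
    [IsProbabilityMeasure P] [IsProbabilityMeasure Q]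
    (hΦ : Measurable Φ) (ha : Integrable a P) (hb : Integrable b Q)
    (hab : ∀ x y, |Φ (x, y)| ≤ a x + b y) (husc : UpperSemicontinuous Φ) :
    ∃ π ∈ couplings P Q, superPrice P Q Φ ≤ ∫ z, Φ z ∂π := by
  have hX : Nonempty X := nonempty_of_isProbabilityMeasure P
  have hY : Nonempty Y := nonempty_of_isProbabilityMeasure Q
  obtain ⟨F, hF⟩ : ∃ F : X → ℕ → unitInterval, IsEmbedding F := by
    let _ := TopologicalSpace.metrizableSpaceMetric X
    exact Metric.PiNatEmbed.exists_embedding_to_hilbert_cube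
  obtain ⟨G, hG⟩ : ∃ G : Y → ℕ → unitInterval, IsEmbedding G := by
    let _ := TopologicalSpace.metrizableSpaceMetric Y
    exact Metric.PiNatEmbed.exists_embedding_to_hilbert_cube
  have hdom : Φ ∈ dominatedClaims P Q := ⟨⟨a, b, ha, hb⟩, .of_forall fun z => hab z.1 z.2⟩
  obtain ⟨L, hLΦ, hL⟩ := exists_linearMap_le_superPrice_eq ⟨Φ, hdom⟩
  obtain ⟨π, hπ, hπL⟩ := exists_coupling_integral_eq_linearMap
    (hF.continuous.measurableEmbedding hF.injective)
    (hG.continuous.measurableEmbedding hG.injective) hL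
  refine ⟨π, hπ, hLΦ.symm.trans_le (linearMap_le_of_min_le ha hb hab hL hdom ?_)⟩
  intro m f hf
  have hint := integrable_of_mem_couplings hΦ ha hb hab hπ
  have hprob : IsFiniteMeasure π := by
    refine ⟨?_⟩
    rw [← Measure.fst_univ, hπ.1]
    exact measure_lt_top P _
  have hintm : Integrable (fun z => min (Φ z) (2 * m)) π := hint.inf (integrable_const _)
  obtain ⟨g, hg_ge, hg_le, hg_lim⟩ := exists_continuousMap_tendsto_of_upperSemicontinuous
    (hF.prodMap hG).isInducing (husc.inf upperSemicontinuous_const)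
    (fun z => min_le_right (Φ z) (2 * (m : ℝ)))
  have hlim : Tendsto (fun n => ∫ z, g n (Prod.map F G z) ∂π) atTop
      (𝓝 (∫ z, min (Φ z) (2 * m) ∂π)) := by
    refine tendsto_integral_of_dominated_convergence
      (fun z => |min (Φ z) (2 * m)| + |2 * (m : ℝ)|)
      (fun n => ((g n).continuous.comp
        (hF.prodMap hG).continuous).measurable.aestronglyMeasurable)
      (hintm.abs.add (integrable_const _)) (fun n => .of_forall fun z => ?_)
      (.of_forall hg_lim)
    have h1 : min (Φ z) (2 * m) ≤ g n (Prod.map F G z) := hg_ge n z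
    have h2 := hg_le n (Prod.map F G z)
    rw [Real.norm_eq_abs, abs_le]
    constructor
    · linarith [neg_abs_le (min (Φ z) (2 * (m : ℝ))), abs_nonneg (2 * (m : ℝ))]
    · linarith [le_abs_self (2 * (m : ℝ)), abs_nonneg (min (Φ z) (2 * (m : ℝ)))]
  refine (ge_of_tendsto' hlim fun n => ?_).trans
    (integral_mono hintm hint fun z => min_le_left _ _)
  rw [hπL]
  exact linearMap_mono hL fun z => (hf z).trans_le (hg_ge n z)

end

section

/-! ### Under-replication and arbitrage -/

variable {X Y : Type*} [MeasurableSpace X] [MeasurableSpace Y] {P : Measure X} {Q : Measure Y}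
  {Φ : X × Y → ℝ} {l : Filter (X × Y)}

/-- Under-replicating `Φ` means over-replicating `-Φ` with the opposite portfolio. -/
theorem underPrices_eq_neg : underPrices l P Q Φ = -overPrices l P Q (fun z => -Φ z) := by
  ext p
  constructor
  · rintro ⟨w, hw, rfl⟩
    refine ⟨(-1 : ℝ) • w, hw.mono fun z hz => ?_, ?_⟩
    · rw [Portfolio.payoff_smul]
      linarith
    · rw [Portfolio.price_smul, neg_one_mul]
  · rintro ⟨w, hw, hp⟩
    refine ⟨(-1 : ℝ) • w, hw.mono fun z hz => ?_, ?_⟩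
    · rw [Portfolio.payoff_smul]
      linarith
    · rw [Portfolio.price_smul]
      linarith

theorem couplingPrices_eq_neg : couplingPrices P Q Φ = -couplingPrices P Q (fun z => -Φ z) := by
  ext p
  simp only [couplingPrices, Set.mem_neg, Set.mem_ofPred_eq, integral_neg, neg_inj]

/-- The arbitrage-free prices are those between the under- and the over-replication price. An
arbitrage opportunity holding `k ≠ 0` options under- or over-replicates `Φ` after division by `|k|`, and
one with `k = 0` is excluded because nonnegative payoffs have nonnegative prices. -/
theorem not_hasArbitrage_iff [IsProbabilityMeasure P] [IsProbabilityMeasure Q]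
    (hl : almostSure P Q ≤ l) {lower upper : ℝ} (hlower : IsLUB (underPrices l P Q Φ) lower)
    (hupper : IsGLB (overPrices l P Q Φ) upper) (V : ℝ) :
    ¬HasArbitrage l P Q Φ V ↔ lower ≤ V ∧ V ≤ upper := by
  constructor
  · intro h
    constructor
    · refine hlower.2 ?_
      rintro _ ⟨w, hw, rfl⟩
      by_contra! hlt
      refine h ⟨(-1 : ℝ) • w, 1, hw.mono fun z hz => ?_, ?_⟩
      · rw [Portfolio.payoff_smul]
        linarith
      · rw [Portfolio.price_smul]
        linarith
    · refine hupper.2 ?_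
      rintro _ ⟨w, hw, rfl⟩
      by_contra! hlt
      exact h ⟨w, -1, hw.mono fun z hz => by linarith, by linarith⟩
  · rintro ⟨hVl, hVu⟩ ⟨w, k, hw, hcost⟩
    rcases lt_trichotomy k 0 with hk | rfl | hk
    · have hmem : ((-k)⁻¹ • w).price ∈ overPrices l P Q Φ := by
        refine ⟨_, hw.mono fun z hz => ?_, rfl⟩
        rw [Portfolio.payoff_smul, le_inv_mul_iff₀ (neg_pos.2 hk)]
        linarith
      have h := hVu.trans (hupper.1 hmem)
      rw [Portfolio.price_smul, le_inv_mul_iff₀ (neg_pos.2 hk)] at h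
      linarith
    · have h := Portfolio.price_mono (w := (0 : ℝ) • w) (w' := w) 
        ((hw.filter_mono hl).mono fun z hz => by simpa using hz)
      rw [Portfolio.price_smul] at h
      linarith
    · have hmem : ((-k⁻¹) • w).price ∈ underPrices l P Q Φ := by
        refine ⟨_, hw.mono fun z hz => ?_, rfl⟩
        have h : -w.payoff z ≤ k * Φ z := by linarith
        rw [← inv_mul_le_iff₀ hk] at h
        rw [Portfolio.payoff_smul]
        linarith
      have h := (hlower.1 hmem).trans hVl
      rw [Portfolio.price_smul, neg_mul, ← mul_neg, inv_mul_le_iff₀ hk] at h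
      linarith

theorem isGreatest_couplingPrices_of_upperSemicontinuous
    [TopologicalSpace X] [PolishSpace X] [BorelSpace X]
    [TopologicalSpace Y] [PolishSpace Y] [BorelSpace Y]
    [IsProbabilityMeasure P] [IsProbabilityMeasure Q] {a : X → ℝ} {b : Y → ℝ}
    (hΦ : Measurable Φ) (ha : Integrable a P) (hb : Integrable b Q)
    (hab : ∀ x y, |Φ (x, y)| ≤ a x + b y) {p : ℝ}
    (hp : IsLeast (overPrices (almostSure P Q) P Q Φ) p) (husc : UpperSemicontinuous Φ) :
    IsGreatest (couplingPrices P Q Φ) p := by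
  obtain ⟨π, hπ, hle⟩ := exists_coupling_superPrice_le_integral hΦ ha hb hab husc
  have hsup : superPrice P Q Φ = p := hp.csInf_eq
  refine ⟨⟨π, hπ, ?_⟩, ?_⟩
  · exact (hsup.symm.trans_le hle).antisymm
      (integral_le_of_mem_overPrices hΦ ha hb hab hπ hp.1)
  · rintro _ ⟨π', hπ', rfl⟩
    exact integral_le_of_mem_overPrices hΦ ha hb hab hπ' hp.1

end

end OptionPricing

theorem mainTheorem6 {X Y : Type*}
    [TopologicalSpace X] [PolishSpace X] [MeasurableSpace X] [BorelSpace X]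
    [TopologicalSpace Y] [PolishSpace Y] [MeasurableSpace Y] [BorelSpace Y]
    (P : Measure X) [IsProbabilityMeasure P] (Q : Measure Y) [IsProbabilityMeasure Q]
    (Φ : X × Y → ℝ) (hΦ : Measurable Φ)
    (a : X → ℝ) (b : Y → ℝ) (ha : Integrable a P) (hb : Integrable b Q)
    (hab : ∀ x y, |Φ (x, y)| ≤ a x + b y) :
    ∃ lower upper : ℝ,
      -- the lower value is the maximal price of an under-replicating portfolio
      IsGreatest (OptionPricing.underPrices (OptionPricing.almostSure P Q) P Q Φ) lower ∧
      IsLUB (OptionPricing.underPrices (OptionPricing.everyState X Y) P Q Φ) lower ∧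
      -- the upper value is the minimal price of an over-replicating portfolio
      IsLeast (OptionPricing.overPrices (OptionPricing.almostSure P Q) P Q Φ) upper ∧
      IsGLB (OptionPricing.overPrices (OptionPricing.everyState X Y) P Q Φ) upper ∧
      -- characterization of the arbitrage-free prices, for both readings of "nonnegative payoff"
      (∀ V : ℝ, ¬ OptionPricing.HasArbitrage (OptionPricing.almostSure P Q) P Q Φ V ↔
        lower ≤ V ∧ V ≤ upper) ∧
      (∀ V : ℝ, ¬ OptionPricing.HasArbitrage (OptionPricing.everyState X Y) P Q Φ V ↔
        lower ≤ V ∧ V ≤ upper) ∧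
      -- Monge-Kantorovich duality
      (∀ π ∈ OptionPricing.couplings P Q, Integrable Φ π) ∧
      (LowerSemicontinuous Φ → IsLeast (OptionPricing.couplingPrices P Q Φ) lower) ∧
      (UpperSemicontinuous Φ → IsGreatest (OptionPricing.couplingPrices P Q Φ) upper) := by
  have hab' : ∀ x y, |(fun z => -Φ z) (x, y)| ≤ a x + b y := fun x y => by
    simpa only [abs_neg] using hab x y
  obtain ⟨upper, hupper⟩ := OptionPricing.exists_isLeast_overPrices ha hb hab
  obtain ⟨p, hp⟩ := OptionPricing.exists_isLeast_overPrices (Φ := fun z => -Φ z) ha hb hab'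
  have hupper' := OptionPricing.isGLB_everyState_of_isLeast_almostSure ha hb hab hupper
  have hp' := OptionPricing.isGLB_everyState_of_isLeast_almostSure ha hb hab' hp
  have hlower : IsGreatest (OptionPricing.underPrices (OptionPricing.almostSure P Q) P Q Φ)
      (-p) := by
    rw [OptionPricing.underPrices_eq_neg]
    exact ⟨Set.neg_mem_neg.2 hp.1, hp.isGLB.neg.1⟩
  have hlower' : IsLUB (OptionPricing.underPrices (OptionPricing.everyState X Y) P Q Φ) (-p) := by
    rw [OptionPricing.underPrices_eq_neg]
    exact hp'.neg
  refine ⟨-p, upper, hlower, hlower', hupper, hupper',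
    OptionPricing.not_hasArbitrage_iff le_rfl hlower.isLUB hupper.isGLB,
    OptionPricing.not_hasArbitrage_iff OptionPricing.almostSure_le_everyState hlower' hupper',
    fun π hπ => OptionPricing.integrable_of_mem_couplings hΦ ha hb hab hπ, fun hlsc => ?_,
    OptionPricing.isGreatest_couplingPrices_of_upperSemicontinuous hΦ ha hb hab hupper⟩
  have h := OptionPricing.isGreatest_couplingPrices_of_upperSemicontinuous hΦ.neg ha hb hab' hp
    hlsc.neg
  rw [OptionPricing.couplingPrices_eq_neg]
  exact ⟨Set.neg_mem_neg.2 h.1, h.isLUB.neg.1⟩
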